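/- A *Kleene algebra* $(K,+,\cdot,{}^*,0,1)$ (in Kozen's sense) is *$*$-continuous* if $a c^* b=\sup_{n\in\mathbb N} a c^n b$ for all $a,b,c\in K$, where $x\le y$ means $x+y=y$. For a monoid $M$, $\mathcal R M$ denotes the $*$-continuous Kleene algebra of regular subsets of $M$: the least family of subsets containing $\emptyset$ and the singletons and closed under union, elementwise product and iteration $A^*=\bigcup_{n}A^n$. For a $*$-continuous Kleene algebra $D$, $\mathcal R D$ refers to the multiplicative monoid of $D$; every $U\in\mathcal R D$ has a least upper bound $\sum U\in D$. An *$\mathcal R$-congruence* on $D$ is a semiring congruence $\rho$ such that, for all $U,U'\in\mathcal R D$, if the sets of classes $U/\rho$ and $U'/\rho$ have the same downward closure in $D/\rho$, then $(\sum U)\,\rho\,(\sum U')$; the quotient $D/\rho$ is then a $*$-continuous Kleene algebra, with $(d/\rho)^*=d^*/\rho$. For $m\in\mathbb N$ let $\Delta_m=\{p_i,q_i : i<m\}$ be an alphabet of $2m$ distinct letters. The *bra-ket algebra* is $C_m=\mathcal R\Delta_m^*/\rho_m$, where $\rho_m$ is the least $\mathcal R$-congruence containing the equations $p_iq_j=\delta_{i,j}$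 $(i,j<m)$ and $\sum_{i<m}q_ip_i=1$ (a letter $x$ stands for $\{x\}$). The *tensor product* of $*$-continuous Kleene algebras $K_1,K_2$ is $K_1\otimes_{\mathcal R}K_2=\mathcal R(K_1\times K_2)/{\equiv}$, where $K_1\times K_2$ is the product of the multiplicative monoids and $\equiv$ is the least $\mathcal R$-congruence containing the equations $A\times B=\{(\sum A,\sum B)\}$ for $A\in\mathcal R K_1$, $B\in\mathcal R K_2$. Finally, $\mathrm{Mat}_m(\mathbb B)$ is the Kleene algebra of $m\times m$ matrices over the boolean Kleene algebra $\mathbb B=\{0,1\}$, with $A^*=\sum_{k}A^k$. **Corollary.** Let $m\in\mathbb N$. 1. The Kleene subalgebra of $C_m$ generated by $\{q_ip_j : i,j<m\}$ is isomorphic, as a Kleene algebra, to $\mathrm{Mat}_m(\mathbb B)$. 2. $C_m\cong C_m\otimes_{\mathcal R}\mathrm{Mat}_m(\mathbb B)$ as Kleene algebras. 3. $C_m$ has no interpretation by finite-dimensional boolean matrices when $m\ge 2$: for all $m\ge2$ and $n\ge1$ there is no semiring homomorphism (in particular, no Kleene algebra homomorphism) $C_m\to\mathrm{Mat}_n(\mathbb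 B)$. -/

import Mathlib

namespace StarKA

open scoped Computability Pointwise

/-! ### Star-continuous Kleene algebras, their isomorphisms, Kleene subalgebras -/

/-- A Kleene algebra `K` is star-continuous if `a * c∗ * b` is the least upper bound of the
elements `a * c ^ n * b`, `n ∈ ℕ`, for all `a b c`. -/
class StarContinuous (K : Type*) [KleeneAlgebra K] : Prop where
  isLUB_mul_kstar_mul : ∀ a b c : K, IsLUB (Set.range fun n : ℕ => a * c ^ n * b) (a * c∗ * b)

/-- Isomorphisms of Kleene algebras: bijections preserving `+`, `*` (hence `0`, `1`) and `∗`. -/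
structure KleeneEquiv (K L : Type*) [KleeneAlgebra K] [KleeneAlgebra L] extends K ≃+* L where
  map_kstar' : ∀ a : K, toFun (a∗) = (toFun a)∗

/-- A Kleene subalgebra: a subset containing `0`, `1` and closed under `+`, `*` and `∗`. -/
structure KleeneSubalgebra (K : Type*) [KleeneAlgebra K] extends Subsemiring K where
  kstar_mem' : ∀ {a : K}, a ∈ carrier → a∗ ∈ carrier

namespace KleeneSubalgebra

/-- The underlying type of a Kleene subalgebra. -/
def Elem {K : Type*} [KleeneAlgebra K] (S : KleeneSubalgebra K) : Type _ := S.toSubsemiring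

instance {K : Type*} [KleeneAlgebra K] (S : KleeneSubalgebra K) : Semiring S.Elem :=
  inferInstanceAs (Semiring S.toSubsemiring)

/-- The operations on a Kleene subalgebra are the restrictions of the ambient ones. -/
instance {K : Type*} [KleeneAlgebra K] (S : KleeneSubalgebra K) : KleeneAlgebra S.Elem where
  __ := IdemSemiring.ofSemiring (α := S.Elem) fun a => Subtype.ext (add_idem a.1)
  kstar a := ⟨a.1∗, S.kstar_mem' a.2⟩
  one_le_kstar a := Subtype.ext (one_le_kstar (a := a.1)).add_eq_right
  mul_kstar_le_kstar a := Subtype.ext (mul_kstar_le_kstar (a := a.1)).add_eq_right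
  kstar_mul_le_kstar a := Subtype.ext (kstar_mul_le_kstar (a := a.1)).add_eq_right
  mul_kstar_le_self a b h := Subtype.ext
    (mul_kstar_le_self (a := a.1) (b := b.1)
      (add_eq_right_iff_le.1 (congrArg Subtype.val h))).add_eq_right
  kstar_mul_le_self a b h := Subtype.ext
    (kstar_mul_le_self (a := a.1) (b := b.1)
      (add_eq_right_iff_le.1 (congrArg Subtype.val h))).add_eq_right

/-- The Kleene subalgebra generated by a set: the intersection of all Kleene subalgebras
containing it. -/
def closure {K : Type*} [KleeneAlgebra K] (s : Set K) : KleeneSubalgebra K where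
  carrier := {a | ∀ S : KleeneSubalgebra K, s ⊆ S.carrier → a ∈ S.carrier}
  zero_mem' := fun S _ => S.zero_mem'
  one_mem' := fun S _ => S.one_mem'
  add_mem' := fun ha hb S hS => S.add_mem' (ha S hS) (hb S hS)
  mul_mem' := fun ha hb S hS => S.mul_mem' (ha S hS) (hb S hS)
  kstar_mem' := fun ha S hS => S.kstar_mem' (ha S hS)

end KleeneSubalgebra

/-! ### The star-continuous Kleene algebra of regular subsets of a monoid -/

/-- The regular (rational) subsets of a monoid: the least family of subsets that contains `∅` and
the singletons and is closed under union, elementwise product and iteration. -/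
inductive IsRegular {M : Type*} [Monoid M] : Set M → Prop
  | empty : IsRegular ∅
  | singleton (a : M) : IsRegular {a}
  | union {A B : Set M} : IsRegular A → IsRegular B → IsRegular (A ∪ B)
  | mul {A B : Set M} : IsRegular A → IsRegular B → IsRegular (A * B)
  | star {A : Set M} : IsRegular A → IsRegular (⋃ n : ℕ, A ^ n)

/-- The set `ℛ M` of regular subsets of the monoid `M`. -/
def RegSet (M : Type*) [Monoid M] : Type _ := {A : Set M // IsRegular A}

namespace RegSet

variable {M : Type*} [Monoid M]

/-- The singleton `{a}` as a regular set. -/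
def single (a : M) : RegSet M := ⟨{a}, .singleton a⟩

instance : Add (RegSet M) := ⟨fun A B => ⟨A.1 ∪ B.1, A.2.union B.2⟩⟩

instance : Zero (RegSet M) := ⟨⟨∅, .empty⟩⟩

instance : Mul (RegSet M) := ⟨fun A B => ⟨A.1 * B.1, A.2.mul B.2⟩⟩

instance : One (RegSet M) := ⟨⟨{1}, .singleton 1⟩⟩

instance : Semiring (RegSet M) where
  nsmul := nsmulRec
  add_assoc A B C := Subtype.ext (Set.union_assoc _ _ _)
  zero_add A := Subtype.ext (Set.empty_union _)
  add_zero A := Subtype.ext (Set.union_empty _)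
  add_comm A B := Subtype.ext (Set.union_comm _ _)
  left_distrib A B C := Subtype.ext Set.mul_union
  right_distrib A B C := Subtype.ext Set.union_mul
  zero_mul A := Subtype.ext Set.empty_mul
  mul_zero A := Subtype.ext Set.mul_empty
  mul_assoc A B C := Subtype.ext (mul_assoc A.1 B.1 C.1)
  one_mul A := Subtype.ext (one_mul A.1)
  mul_one A := Subtype.ext (mul_one A.1)

instance : IdemSemiring (RegSet M) :=
  IdemSemiring.ofSemiring fun A => Subtype.ext (Set.union_self A.1)

theorem le_iff {A B : RegSet M} : A ≤ B ↔ A.1 ⊆ B.1 :=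
  add_eq_right_iff_le.symm.trans (Subtype.ext_iff.trans Set.union_eq_right)

theorem val_pow (A : RegSet M) (n : ℕ) : (A ^ n).1 = A.1 ^ n := by
  induction n with
  | zero => rw [pow_zero, pow_zero]; rfl
  | succ n ih => rw [pow_succ, pow_succ, ← ih]; rfl

instance : KStar (RegSet M) := ⟨fun A => ⟨⋃ n : ℕ, A.1 ^ n, A.2.star⟩⟩

theorem isLUB_aux (A B C : RegSet M) :
    IsLUB (Set.range fun n : ℕ => A * C ^ n * B) (A * C∗ * B) := by
  have key : (A * C∗ * B).1 = ⋃ n : ℕ, (A * C ^ n * B).1 := by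
    change A.1 * (⋃ n : ℕ, C.1 ^ n) * B.1 = ⋃ n : ℕ, A.1 * (C ^ n).1 * B.1
    simp only [Set.mul_iUnion, Set.iUnion_mul, val_pow]
  constructor
  · rintro _ ⟨n, rfl⟩
    rw [le_iff, key]
    exact Set.subset_iUnion (fun n : ℕ => (A * C ^ n * B).1) n
  · intro X hX
    rw [le_iff, key]
    exact Set.iUnion_subset fun n => le_iff.1 (hX ⟨n, rfl⟩)

theorem mul_pow_le {K : Type*} [IdemSemiring K] {a b : K} (h : b * a ≤ b) (n : ℕ) :
    b * a ^ n ≤ b := by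
  induction n with
  | zero => simp
  | succ n ih =>
    rw [pow_succ, ← mul_assoc]
    exact (mul_le_mul_left ih a).trans h

theorem pow_mul_le {K : Type*} [IdemSemiring K] {a b : K} (h : a * b ≤ b) (n : ℕ) :
    a ^ n * b ≤ b := by
  induction n with
  | zero => simp
  | succ n ih =>
    rw [pow_succ', mul_assoc]
    exact (mul_le_mul_right ih a).trans h

end RegSet

/-- A star-continuous star operation on an idempotent semiring makes it a Kleene algebra. -/
abbrev kleeneOfIsLUB {K : Type*} [IdemSemiring K] [KStar K]
    (H : ∀ a b c : K, IsLUB (Set.range fun n : ℕ => a * c ^ n * b) (a * c∗ * b)) :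
    KleeneAlgebra K where
  one_le_kstar a := by simpa using (H 1 1 a).1 ⟨0, rfl⟩
  mul_kstar_le_kstar a := by
    have h := (isLUB_le_iff (H a 1 a) (b := a∗)).2 (by
      rintro _ ⟨n, rfl⟩
      have := (H 1 1 a).1 ⟨n + 1, rfl⟩
      simpa [pow_succ'] using this)
    simpa using h
  kstar_mul_le_kstar a := by
    have h := (isLUB_le_iff (H 1 a a) (b := a∗)).2 (by
      rintro _ ⟨n, rfl⟩
      have := (H 1 1 a).1 ⟨n + 1, rfl⟩
      simpa [pow_succ] using this)
    simpa using h
  mul_kstar_le_self a b hab := by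
    have h := (isLUB_le_iff (H b 1 a) (b := b)).2 (by
      rintro _ ⟨n, rfl⟩
      simpa using RegSet.mul_pow_le hab n)
    simpa using h
  kstar_mul_le_self a b hab := by
    have h := (isLUB_le_iff (H 1 b a) (b := b)).2 (by
      rintro _ ⟨n, rfl⟩
      simpa using RegSet.pow_mul_le hab n)
    simpa using h

instance {M : Type*} [Monoid M] : KleeneAlgebra (RegSet M) := kleeneOfIsLUB RegSet.isLUB_aux

instance {M : Type*} [Monoid M] : StarContinuous (RegSet M) := ⟨RegSet.isLUB_aux⟩

/-! ### `ℛ`-congruences and quotients -/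

instance {D : Type*} [IdemSemiring D] (c : RingCon D) : IdemSemiring c.Quotient :=
  IdemSemiring.ofSemiring fun x => by
    induction x using Quotient.inductionOn' with
    | h a => exact congrArg (fun d : D => (d : c.Quotient)) (add_idem a)

/-- A semiring congruence `c` on `D` is an `ℛ`-congruence if any two regular subsets `U`, `U'` of
(the multiplicative monoid of) `D` whose sets of classes have the same downward closure in the
quotient have congruent least upper bounds. -/
def IsRCongruence {D : Type*} [IdemSemiring D] (c : RingCon D) : Prop :=
  ∀ U U' : Set D, IsRegular U → IsRegular U' →
    lowerClosure ((fun d : D => (d : c.Quotient)) '' U) =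
      lowerClosure ((fun d : D => (d : c.Quotient)) '' U') →
    ∀ u u' : D, IsLUB U u → IsLUB U' u' → c u u'

/-- The least `ℛ`-congruence containing the relation `r`. -/
def rCongruenceGen {D : Type*} [IdemSemiring D] (r : D → D → Prop) : RingCon D :=
  sInf {c : RingCon D | IsRCongruence c ∧ ∀ x y, r x y → c x y}

theorem coe_le_coe {D : Type*} [IdemSemiring D] (c : RingCon D) {a b : D} :
    (a : c.Quotient) ≤ (b : c.Quotient) ↔ c (a + b) b :=
  add_eq_right_iff_le.symm.trans (c.eq (a := a + b) (b := b))

theorem coe_mono {D : Type*} [IdemSemiring D] (c : RingCon D) {a b : D} (h : a ≤ b) :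
    (a : c.Quotient) ≤ (b : c.Quotient) := by
  rw [coe_le_coe, h.add_eq_right]
  exact c.refl b

theorem lowerClosure_le_iff {D : Type*} [IdemSemiring D] (c : RingCon D) {U U' : Set D} :
    lowerClosure ((fun d : D => (d : c.Quotient)) '' U) ≤
      lowerClosure ((fun d : D => (d : c.Quotient)) '' U') ↔
    ∀ d ∈ U, ∃ d' ∈ U', (d : c.Quotient) ≤ (d' : c.Quotient) := by
  rw [lowerClosure_le]
  constructor
  · intro h d hd
    obtain ⟨_, ⟨d', hd', rfl⟩, hle⟩ := h ⟨d, hd, rfl⟩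
    exact ⟨d', hd', hle⟩
  · rintro h _ ⟨d, hd, rfl⟩
    obtain ⟨d', hd', hle⟩ := h d hd
    exact ⟨_, ⟨d', hd', rfl⟩, hle⟩

theorem rCongruenceGen_le {D : Type*} [IdemSemiring D] {r : D → D → Prop} {c : RingCon D}
    (h1 : IsRCongruence c) (h2 : ∀ x y, r x y → c x y) : rCongruenceGen r ≤ c :=
  sInf_le ⟨h1, h2⟩

theorem rCongruenceGen_iff {D : Type*} [IdemSemiring D] {r : D → D → Prop} {x y : D} :
    rCongruenceGen r x y ↔
      ∀ c : RingCon D, IsRCongruence c → (∀ x y, r x y → c x y) → c x y := by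
  change (∀ c ∈ {c : RingCon D | IsRCongruence c ∧ ∀ x y, r x y → c x y}, c x y) ↔ _
  exact ⟨fun h c h1 h2 => h c ⟨h1, h2⟩, fun h c hc => h c hc.1 hc.2⟩

theorem rCongruenceGen_of {D : Type*} [IdemSemiring D] {r : D → D → Prop} {x y : D}
    (h : r x y) : rCongruenceGen r x y :=
  rCongruenceGen_iff.2 fun _ _ h2 => h2 x y h

theorem rCongruenceGen_isRCongruence {D : Type*} [IdemSemiring D] (r : D → D → Prop) :
    IsRCongruence (rCongruenceGen r) := by
  intro U U' hU hU' he u u' hu hu'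
  have h1 := (lowerClosure_le_iff _).1 he.le
  have h2 := (lowerClosure_le_iff _).1 he.ge
  rw [rCongruenceGen_iff]
  intro c hc hr
  have hle := rCongruenceGen_le hc hr
  refine hc U U' hU hU' (le_antisymm ?_ ?_) u u' hu hu' <;> rw [lowerClosure_le_iff]
  · intro d hd
    obtain ⟨d', hd', h⟩ := h1 d hd
    exact ⟨d', hd', (coe_le_coe c).2 (hle ((coe_le_coe _).1 h))⟩
  · intro d hd
    obtain ⟨d', hd', h⟩ := h2 d hd
    exact ⟨d', hd', (coe_le_coe c).2 (hle ((coe_le_coe _).1 h))⟩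

section Quotient

theorem isRegular_range {D : Type*} [Monoid D] (a b c : D) : IsRegular (Set.range fun n : ℕ => a * c ^ n * b) := by
  have h := ((IsRegular.singleton a).mul (IsRegular.singleton c).star).mul (IsRegular.singleton b)
  convert h using 1
  ext x
  simp [eq_comm]

variable {D : Type*} [KleeneAlgebra D] [StarContinuous D]

theorem star_congr {c : RingCon D} (hc : IsRCongruence c) {a b : D} (h : c a b) :
    c (a∗) (b∗) := by
  have hr : ∀ x : D, IsRegular (Set.range fun n : ℕ => x ^ n) := fun x => by
    simpa using isRegular_range 1 1 x
  have hl : ∀ x : D, IsLUB (Set.range fun n : ℕ => x ^ n) (x∗) := fun x => by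
    simpa using StarContinuous.isLUB_mul_kstar_mul 1 1 x
  refine hc _ _ (hr a) (hr b) ?_ _ _ (hl a) (hl b)
  rw [← Set.range_comp, ← Set.range_comp]
  congr 2
  funext n
  exact c.eq.2 (c.pow n h)

/-- The quotient `D/ρ` of `D` by the least `ℛ`-congruence `ρ` containing `r`. -/
def RQuot (r : D → D → Prop) : Type _ := (rCongruenceGen r).Quotient

namespace RQuot

variable (r : D → D → Prop)

instance : IdemSemiring (RQuot r) := inferInstanceAs (IdemSemiring (rCongruenceGen r).Quotient)

/-- The quotient map `d ↦ d/ρ`. -/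
def mk : D →+* RQuot r := (rCongruenceGen r).mk'

/-- Iteration on the quotient: `(d/ρ)∗ = d∗/ρ`. -/
instance : KStar (RQuot r) :=
  ⟨Quotient.map' (fun d : D => d∗) fun _ _ h => star_congr (rCongruenceGen_isRCongruence r) h⟩

theorem mk_kstar (d : D) : mk r (d∗) = (mk r d)∗ := rfl

theorem mk_surjective : Function.Surjective (mk r) := (rCongruenceGen r).mk'_surjective

theorem mk_eq_iff {a b : D} : mk r a = mk r b ↔ rCongruenceGen r a b := (rCongruenceGen r).eq

theorem isLUB_aux (x y z : RQuot r) :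
    IsLUB (Set.range fun n : ℕ => x * z ^ n * y) (x * z∗ * y) := by
  obtain ⟨a, rfl⟩ := mk_surjective r x
  obtain ⟨b, rfl⟩ := mk_surjective r y
  obtain ⟨c, rfl⟩ := mk_surjective r z
  have hl := StarContinuous.isLUB_mul_kstar_mul a b c
  have hcoe : ∀ n : ℕ, mk r a * mk r c ^ n * mk r b = mk r (a * c ^ n * b) := by simp
  constructor
  · rintro _ ⟨n, rfl⟩
    simp only [hcoe, ← mk_kstar, ← map_mul]
    exact coe_mono _ (hl.1 ⟨n, rfl⟩)
  · intro X hX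
    obtain ⟨d, rfl⟩ := mk_surjective r X
    rw [← mk_kstar, ← map_mul, ← map_mul]
    refine (coe_le_coe _).2 ?_
    refine rCongruenceGen_isRCongruence r (Set.range (fun n : ℕ => a * c ^ n * b) ∪ {d}) {d}
      ((isRegular_range a b c).union (.singleton d)) (.singleton d) (le_antisymm ?_ ?_) _ _
      (by simpa [add_eq_sup] using hl.union (isLUB_singleton (a := d))) isLUB_singleton
    · rw [lowerClosure_le_iff]
      rintro e (⟨n, rfl⟩ | he)
      · refine ⟨d, rfl, ?_⟩
        have := hX ⟨n, rfl⟩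
        simp only [hcoe] at this
        exact this
      · exact ⟨e, he, le_rfl⟩
    · rw [lowerClosure_le_iff]
      exact fun e he => ⟨e, Or.inr he, le_rfl⟩

instance : KleeneAlgebra (RQuot r) := kleeneOfIsLUB (isLUB_aux r)

instance : StarContinuous (RQuot r) := ⟨isLUB_aux r⟩

end RQuot

end Quotient

/-! ### The bra-ket algebras -/

/-- The alphabet `Δ_m` of `m` bracket pairs: opening brackets `p i`, closing brackets `q i`. -/
inductive Bracket (m : ℕ) : Type
  | p (i : Fin m) : Bracket m
  | q (i : Fin m) : Bracket m

/-- A letter of `Δ_m` as an element `{x}` of `ℛ Δ_m^*`. -/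
def letter {m : ℕ} (x : Bracket m) : RegSet (FreeMonoid (Bracket m)) :=
  RegSet.single (FreeMonoid.of x)

/-- The match equations `p_i q_j = δ_{i,j}` and the completeness equation `∑ q_i p_i = 1`. -/
inductive BraKetRel (m : ℕ) :
    RegSet (FreeMonoid (Bracket m)) → RegSet (FreeMonoid (Bracket m)) → Prop
  | matching (i j : Fin m) :
      BraKetRel m (letter (.p i) * letter (.q j)) (if i = j then 1 else 0)
  | completeness : BraKetRel m (∑ i : Fin m, letter (.q i) * letter (.p i)) 1

/-- The bra-ket algebra `C_m = ℛ Δ_m^* / ρ_m`. -/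
abbrev BraKet (m : ℕ) : Type := RQuot (BraKetRel m)

/-- The class of `p_i` in `C_m`. -/
def BraKet.p {m : ℕ} (i : Fin m) : BraKet m := RQuot.mk (BraKetRel m) (letter (.p i))

/-- The class of `q_i` in `C_m`. -/
def BraKet.q {m : ℕ} (i : Fin m) : BraKet m := RQuot.mk (BraKetRel m) (letter (.q i))

/-! ### Tensor products -/

/-- The tensor product equations `A × B = {(∑ A, ∑ B)}` for regular `A ⊆ K₁`, `B ⊆ K₂`, where `∑`
is the least upper bound. -/
inductive TensorRel (K₁ K₂ : Type*) [KleeneAlgebra K₁] [KleeneAlgebra K₂] :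
    RegSet (K₁ × K₂) → RegSet (K₁ × K₂) → Prop
  | intro {A : Set K₁} {B : Set K₂} (hA : IsRegular A) (hB : IsRegular B) {a : K₁} {b : K₂}
      (ha : IsLUB A a) (hb : IsLUB B b) (R : RegSet (K₁ × K₂)) (hR : R.1 = A ×ˢ B) :
      TensorRel K₁ K₂ R (RegSet.single (a, b))

/-- The tensor product `K₁ ⊗_ℛ K₂ = ℛ (K₁ × K₂) / ≡` of star-continuous Kleene algebras, where `≡`
is the least `ℛ`-congruence containing the tensor product equations. -/
abbrev RTensor (K₁ K₂ : Type*) [KleeneAlgebra K₁] [StarContinuous K₁]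
    [KleeneAlgebra K₂] [StarContinuous K₂] : Type _ := RQuot (TensorRel K₁ K₂)

/-! ### Boolean matrices -/

/-- The boolean Kleene algebra `𝔹 = {0, 1}` with `+` disjunction, `*` conjunction, and `x∗ = 1`. -/
inductive BoolKA : Type
  | zero : BoolKA
  | one : BoolKA

namespace BoolKA

instance : Zero BoolKA := ⟨.zero⟩

instance : One BoolKA := ⟨.one⟩

instance : Add BoolKA := ⟨fun a b => match a with | .zero => b | .one => .one⟩

instance : Mul BoolKA := ⟨fun a b => match a with | .zero => .zero | .one => b⟩

instance : Semiring BoolKA where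
  nsmul := nsmulRec
  add_assoc a b c := by cases a <;> rfl
  zero_add a := rfl
  add_zero a := by cases a <;> rfl
  add_comm a b := by cases a <;> cases b <;> rfl
  left_distrib a b c := by cases a <;> rfl
  right_distrib a b c := by cases a <;> cases b <;> cases c <;> rfl
  zero_mul a := rfl
  mul_zero a := by cases a <;> rfl
  mul_assoc a b c := by cases a <;> rfl
  one_mul a := rfl
  mul_one a := by cases a <;> rfl

instance : IdemSemiring BoolKA := IdemSemiring.ofSemiring fun a => by cases a <;> rfl

instance : KleeneAlgebra BoolKA where
  kstar _ := 1
  one_le_kstar _ := le_rfl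
  mul_kstar_le_kstar a := by cases a <;> rfl
  kstar_mul_le_kstar a := by cases a <;> rfl
  mul_kstar_le_self a b _ := (mul_one b).le
  kstar_mul_le_self a b _ := (one_mul b).le

theorem eq_zero_or_one (a : BoolKA) : a = 0 ∨ a = 1 := by
  cases a
  · exact Or.inl rfl
  · exact Or.inr rfl

theorem zero_ne_one' : (0 : BoolKA) ≠ 1 := fun h => BoolKA.noConfusion h

theorem eq_one_of_ne_zero {a : BoolKA} (h : a ≠ 0) : a = 1 := (eq_zero_or_one a).resolve_left h

theorem le_iff {a b : BoolKA} : a ≤ b ↔ (a = 1 → b = 1) := by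
  rcases eq_zero_or_one a with rfl | rfl
  · exact iff_of_true bot_le fun h => absurd h zero_ne_one'
  · exact add_eq_right_iff_le.symm.trans
      ⟨fun h _ => h.symm, fun h => (h rfl).symm⟩

theorem mul_eq_one {a b : BoolKA} : a * b = 1 ↔ a = 1 ∧ b = 1 := by
  cases a
  · exact iff_of_false zero_ne_one' fun h => zero_ne_one' h.1
  · exact ⟨fun h => ⟨rfl, h⟩, fun h => h.2⟩

theorem sum_eq_one {ι : Type*} {s : Finset ι} {f : ι → BoolKA} :
    ∑ i ∈ s, f i = 1 ↔ ∃ i ∈ s, f i = 1 := by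
  constructor
  · intro h
    by_contra hne
    refine zero_ne_one' ((Finset.sum_eq_zero fun i hi => ?_).symm.trans h)
    exact (eq_zero_or_one _).resolve_right fun h1 => hne ⟨i, hi, h1⟩
  · rintro ⟨i, hi, h⟩
    exact le_iff.1 (Finset.single_le_sum_of_canonicallyOrdered hi) h

end BoolKA

/-- Square matrices over an idempotent semiring, with the usual matrix operations and the
corresponding (entrywise) order. -/
instance {n : ℕ} {K : Type*} [IdemSemiring K] : IdemSemiring (Matrix (Fin n) (Fin n) K) :=
  IdemSemiring.ofSemiring fun A => Matrix.ext fun i j => add_idem (A i j)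

/-- The algebra `Mat_n(𝔹)` of boolean `n × n` matrices. -/
abbrev BoolMat (n : ℕ) : Type := Matrix (Fin n) (Fin n) BoolKA

namespace BoolMat

variable {n : ℕ}

open Classical in
/-- Iteration of boolean matrices: `A∗ = ∑_k A ^ k`, the reflexive transitive closure. -/
noncomputable instance : KStar (BoolMat n) :=
  ⟨fun A => Matrix.of fun i j => if ∃ k : ℕ, (A ^ k) i j = 1 then 1 else 0⟩

theorem kstar_apply_eq_one {A : BoolMat n} {i j : Fin n} :
    A∗ i j = 1 ↔ ∃ k : ℕ, (A ^ k) i j = 1 := by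
  classical
  by_cases h : ∃ k : ℕ, (A ^ k) i j = 1
  · exact iff_of_true (if_pos h) h
  · exact iff_of_false (fun e => BoolKA.zero_ne_one' ((if_neg h).symm.trans e)) h

theorem le_iff {A B : BoolMat n} : A ≤ B ↔ ∀ i j, A i j = 1 → B i j = 1 := by
  rw [← add_eq_right_iff_le, ← Matrix.ext_iff]
  refine forall_congr' fun i => forall_congr' fun j => ?_
  rw [Matrix.add_apply, add_eq_right_iff_le, BoolKA.le_iff]

theorem mul_apply_eq_one {A B : BoolMat n} {i j : Fin n} :
    (A * B) i j = 1 ↔ ∃ k, A i k = 1 ∧ B k j = 1 := by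
  simp [Matrix.mul_apply, BoolKA.sum_eq_one, BoolKA.mul_eq_one]

theorem isLUB_aux (A B C : BoolMat n) :
    IsLUB (Set.range fun k : ℕ => A * C ^ k * B) (A * C∗ * B) := by
  constructor
  · rintro _ ⟨k, rfl⟩
    rw [le_iff]
    intro i j h
    obtain ⟨t, h1, h2⟩ := mul_apply_eq_one.1 h
    obtain ⟨s, h3, h4⟩ := mul_apply_eq_one.1 h1
    exact mul_apply_eq_one.2
      ⟨t, mul_apply_eq_one.2 ⟨s, h3, kstar_apply_eq_one.2 ⟨k, h4⟩⟩, h2⟩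
  · intro X hX
    rw [le_iff]
    intro i j h
    obtain ⟨t, h1, h2⟩ := mul_apply_eq_one.1 h
    obtain ⟨s, h3, h4⟩ := mul_apply_eq_one.1 h1
    obtain ⟨k, hk⟩ := kstar_apply_eq_one.1 h4
    exact le_iff.1 (hX ⟨k, rfl⟩) i j
      (mul_apply_eq_one.2 ⟨t, mul_apply_eq_one.2 ⟨s, h3, hk⟩, h2⟩)

noncomputable instance : KleeneAlgebra (BoolMat n) := kleeneOfIsLUB isLUB_aux

instance : StarContinuous (BoolMat n) := ⟨isLUB_aux⟩

end BoolMat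

end StarKA

/-! The core is the isomorphism of semirings `Mat_m(C_m) ≅ C_m`, given by `A ↦ ∑ q_i A_ij p_j` with
inverse `a ↦ (p_i a q_j)`: one round trip uses the match equations, the other the completeness
equation (`matrixEquiv`).

Restricted to matrices with entries `0` and `1`, it sends the matrix unit `E_ij` to `q_i p_j`. Its
image is the Kleene subalgebra in question (`mem_closure_iff`). It is injective because `0 ≠ 1` in
`C_m` for `m > 0`, as shown by letting the brackets act as relations on infinite sequences
(`streamHom`).

For the second claim, `A ↦ ∑ A_ij ⊗ E_ij` and `a ⊗ B ↦ (a B_ij)` identify `Mat_m(C_m)` with `C_m ⊗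
Mat_m(𝔹)`; composing with the core isomorphism gives `toTensor` and `ofTensor`. No iteration on
`Mat_m(C_m)` is needed: one inequality for stars holds for every semiring homomorphism
(`kstar_map_le`), the other comes from finiteness or from star-continuity.

For the third claim, in a finite monoid `p_i q_i = 1` forces `q_i p_i = 1`, so that `p_j = p_j q_i
p_i = 0` for `j ≠ i`.

Homomorphisms out of the quotients come from a general principle: a monoid homomorphism into a
star-continuous algebra extends to regular sets by taking suprema (`evalHom`), and kernels of
star-preserving homomorphisms are `ℛ`-congruences (`isRCongruence_ker`). -/

namespace StarKA

open scoped Computability Pointwise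

/-! ### Suprema of regular sets -/

section MulLUB

variable {M K : Type*} [KleeneAlgebra K]

/-- `u` is the least upper bound of `h '' U`, stably under multiplication from both sides. -/
def IsMulLUB (h : M → K) (U : Set M) (u : K) : Prop :=
  ∀ a b X : K, a * u * b ≤ X ↔ ∀ x ∈ U, a * h x * b ≤ X

namespace IsMulLUB

theorem isLUB {h : M → K} {U : Set M} {u : K} (H : IsMulLUB h U u) : IsLUB (h '' U) u := by
  rw [isLUB_iff_le_iff]
  intro X
  simpa [upperBounds] using H 1 1 X

theorem unique {h : M → K} {U : Set M} {u v : K} (H : IsMulLUB h U u) (H' : IsMulLUB h U v) :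
    u = v :=
  H.isLUB.unique H'.isLUB

theorem empty (h : M → K) : IsMulLUB h ∅ 0 := fun a b X => by simp

theorem singleton (h : M → K) (x : M) : IsMulLUB h {x} (h x) := fun a b X => by simp

theorem union {h : M → K} {U V : Set M} {u v : K} (hu : IsMulLUB h U u) (hv : IsMulLUB h V v) :
    IsMulLUB h (U ∪ V) (u + v) := fun a b X => by
  rw [mul_add, add_mul, add_le_iff, hu, hv]
  simp [or_imp, forall_and]

variable [Monoid M]

/-- The outer factors in `IsMulLUB` are what make the induction on regular sets work: the supremum
over `V` is taken with left factor `a * u`, then the one over `U` with right factor `h y * b`. A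
bare least upper bound would not pass through the product. -/
theorem mul {h : M →* K} {U V : Set M} {u v : K} (hu : IsMulLUB h U u) (hv : IsMulLUB h V v) :
    IsMulLUB h (U * V) (u * v) := fun a b X => by
  rw [← mul_assoc, hv (a * u) b]
  have : ∀ y, a * u * h y * b ≤ X ↔ ∀ x ∈ U, a * h (x * y) * b ≤ X := fun y => by
    rw [mul_assoc, hu a (h y * b)]
    simp only [map_mul, mul_assoc]
  simp only [this]
  constructor
  · rintro H _ ⟨x, hx, y, hy, rfl⟩
    exact H y hy x hx
  · exact fun H y hy x hx => H _ ⟨x, hx, y, hy, rfl⟩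

theorem pow {h : M →* K} {U : Set M} {u : K} (hu : IsMulLUB h U u) (n : ℕ) :
    IsMulLUB h (U ^ n) (u ^ n) := by
  induction n with
  | zero =>
    rw [pow_zero, pow_zero, ← Set.singleton_one, ← map_one h]
    exact singleton h 1
  | succ n ih => simpa only [pow_succ] using ih.mul hu

variable [StarContinuous K]

theorem star {h : M →* K} {U : Set M} {u : K} (hu : IsMulLUB h U u) :
    IsMulLUB h (⋃ n : ℕ, U ^ n) (u∗) := fun a b X => by
  rw [isLUB_le_iff (StarContinuous.isLUB_mul_kstar_mul a b u)]
  simp only [mem_upperBounds, Set.forall_mem_range, fun n : ℕ => hu.pow n a b X, Set.mem_iUnion]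
  exact ⟨fun H x ⟨n, hn⟩ => H n x hn, fun H n x hn => H x ⟨n, hn⟩⟩

end IsMulLUB

variable {D : Type*} [Monoid M] [StarContinuous K] [KleeneAlgebra D] [StarContinuous D]

theorem exists_isMulLUB (h : M →* K) {U : Set M} (hU : IsRegular U) : ∃ u, IsMulLUB h U u := by
  induction hU with
  | empty => exact ⟨_, .empty h⟩
  | singleton a => exact ⟨_, .singleton h a⟩
  | union _ _ ihA ihB => exact ⟨_, ihA.choose_spec.union ihB.choose_spec⟩
  | mul _ _ ihA ihB => exact ⟨_, ihA.choose_spec.mul ihB.choose_spec⟩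
  | star _ ih => exact ⟨_, ih.choose_spec.star⟩

/-- A star-preserving semiring homomorphism preserves least upper bounds of regular sets. -/
theorem isMulLUB_map {φ : D →+* K} (hφ : ∀ a, φ (a∗) = (φ a)∗) {U : Set D} (hU : IsRegular U)
    {u : D} (hu : IsLUB U u) : IsMulLUB φ U (φ u) := by
  -- A given supremum of a compound set says nothing about its parts, so the induction builds a
  -- supremum `v` of its own, in `D` and in `K` at once; uniqueness then gives `u = v`.
  have key : ∃ v, IsMulLUB (MonoidHom.id D) U v ∧ IsMulLUB (φ : D →* K) U (φ v) := by
    clear hu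
    induction hU with
    | empty => exact ⟨0, .empty _, by simpa using IsMulLUB.empty _⟩
    | singleton a => exact ⟨a, .singleton _ a, .singleton _ a⟩
    | union _ _ ihA ihB =>
      obtain ⟨⟨u, h1, h2⟩, v, h3, h4⟩ := And.intro ihA ihB
      exact ⟨_, h1.union h3, by rw [map_add]; exact h2.union h4⟩
    | mul _ _ ihA ihB =>
      obtain ⟨⟨u, h1, h2⟩, v, h3, h4⟩ := And.intro ihA ihB
      exact ⟨_, h1.mul h3, by simpa using h2.mul h4⟩
    | star _ ih =>
      obtain ⟨u, h1, h2⟩ := ih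
      exact ⟨_, h1.star, by simpa [hφ] using h2.star⟩
  obtain ⟨v, h1, h2⟩ := key
  have h3 := h1.isLUB
  rw [MonoidHom.coe_id, Set.image_id] at h3
  rw [hu.unique h3]
  exact h2

/-- The extension of a monoid homomorphism `M → K` to regular sets, `U ↦ ∑ h(U)`. -/
noncomputable def evalHom (h : M →* K) : RegSet M →+* K where
  toFun U := (exists_isMulLUB h U.2).choose
  map_zero' := (exists_isMulLUB h (0 : RegSet M).2).choose_spec.unique (.empty h)
  map_one' := (exists_isMulLUB h (1 : RegSet M).2).choose_spec.unique
    (by rw [← map_one h]; exact .singleton h 1)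
  map_add' U V := (exists_isMulLUB h (U + V).2).choose_spec.unique
    ((exists_isMulLUB h U.2).choose_spec.union (exists_isMulLUB h V.2).choose_spec)
  map_mul' U V := (exists_isMulLUB h (U * V).2).choose_spec.unique
    ((exists_isMulLUB h U.2).choose_spec.mul (exists_isMulLUB h V.2).choose_spec)

theorem isMulLUB_evalHom (h : M →* K) (U : RegSet M) : IsMulLUB h U.1 (evalHom h U) :=
  (exists_isMulLUB h U.2).choose_spec

theorem evalHom_single (h : M →* K) (x : M) : evalHom h (RegSet.single x) = h x :=
  (isMulLUB_evalHom h _).unique (.singleton h x)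

theorem evalHom_kstar (h : M →* K) (U : RegSet M) : evalHom h (U∗) = (evalHom h U)∗ :=
  (isMulLUB_evalHom h _).unique (isMulLUB_evalHom h U).star

theorem map_mono {R S : Type*} [IdemSemiring R] [IdemSemiring S] (φ : R →+* S) : Monotone φ :=
  fun a b hab => by rw [← add_eq_right_iff_le, ← map_add, hab.add_eq_right]

/-- The kernel of a star-preserving semiring homomorphism is an `ℛ`-congruence. -/
theorem isRCongruence_ker {φ : D →+* K} (hφ : ∀ a, φ (a∗) = (φ a)∗) :
    IsRCongruence (RingCon.ker φ) := by
  have key : ∀ U U' : Set D, IsRegular U → IsRegular U' →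
      lowerClosure ((fun d : D => (d : (RingCon.ker φ).Quotient)) '' U) ≤
        lowerClosure ((fun d : D => (d : (RingCon.ker φ).Quotient)) '' U') →
      ∀ u u' : D, IsLUB U u → IsLUB U' u' → φ u ≤ φ u' := by
    intro U U' hU hU' hle u u' hu hu'
    rw [isLUB_le_iff (isMulLUB_map hφ hU hu).isLUB]
    rintro _ ⟨d, hd, rfl⟩
    obtain ⟨d', hd', h⟩ := (lowerClosure_le_iff _).1 hle d hd
    -- The order of the quotient by the kernel is the order of the images under `φ`.
    have h' : φ (d + d') = φ d' := (coe_le_coe _).1 h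
    rw [map_add, add_eq_right_iff_le] at h'
    exact h'.trans (map_mono φ (hu'.1 hd'))
  intro U U' hU hU' he u u' hu hu'
  exact le_antisymm (key U U' hU hU' he.le u u' hu hu') (key U' U hU' hU he.ge u' u hu' hu)

end MulLUB

/-! ### Universal property of the quotient by a generated `ℛ`-congruence -/

namespace RQuot

variable {D K : Type*} [KleeneAlgebra D] [StarContinuous D] [KleeneAlgebra K] [StarContinuous K]

/-- The homomorphism on the quotient induced by a star-preserving homomorphism. -/
def lift (r : D → D → Prop) (φ : D →+* K) (hφ : ∀ a, φ (a∗) = (φ a)∗)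
    (hr : ∀ x y, r x y → φ x = φ y) : RQuot r →+* K :=
  (rCongruenceGen r).lift φ (rCongruenceGen_le (isRCongruence_ker hφ) hr)

theorem lift_mk (r : D → D → Prop) (φ : D →+* K) (hφ : ∀ a, φ (a∗) = (φ a)∗)
    (hr : ∀ x y, r x y → φ x = φ y) (d : D) : lift r φ hφ hr (mk r d) = φ d := rfl

theorem lift_kstar (r : D → D → Prop) (φ : D →+* K) (hφ : ∀ a, φ (a∗) = (φ a)∗)
    (hr : ∀ x y, r x y → φ x = φ y) (x : RQuot r) :
    lift r φ hφ hr (x∗) = (lift r φ hφ hr x)∗ := by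
  obtain ⟨d, rfl⟩ := mk_surjective r x
  rw [← mk_kstar, lift_mk, lift_mk, hφ]

end RQuot

/-! ### Semiring homomorphisms and iteration -/

section KStar

variable {D K : Type*} [KleeneAlgebra D] [KleeneAlgebra K]

/-- `φ (a∗)` lies above `1` and is closed under left multiplication by `φ a`, hence dominates the
least such element. -/
theorem kstar_map_le (φ : D →+* K) (a : D) : (φ a)∗ ≤ φ (a∗) := by
  have h1 : 1 ≤ φ (a∗) := by simpa using map_mono φ (one_le_kstar (a := a))
  have h2 : φ a * φ (a∗) ≤ φ (a∗) := by
    simpa using map_mono φ (mul_kstar_le_kstar (a := a))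
  exact kstar_le_of_mul_le_right h1 h2

/-- A semiring homomorphism from a finite star-continuous Kleene algebra preserves iteration. -/
theorem map_kstar_of_finite [StarContinuous D] [Finite D] (φ : D →+* K) (a : D) :
    φ (a∗) = (φ a)∗ := by
  refine le_antisymm ?_ (kstar_map_le φ a)
  have hone : (1 : D) ≤ 1 + a := le_self_add
  have hmono : Monotone fun n : ℕ => (1 + a) ^ n := monotone_nat_of_le_succ fun n => by
    rw [pow_succ]
    simpa using mul_le_mul_right hone ((1 + a) ^ n)
  -- The increasing powers of `1 + a` must repeat, hence are stationary from `i` on. So `a∗` is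
  -- bounded by the polynomial `(1 + a) ^ i`, which `φ` preserves.
  obtain ⟨i, j, hij, he⟩ : ∃ i j : ℕ, i < j ∧ (1 + a) ^ i = (1 + a) ^ j := by
    obtain ⟨i, j, hne, he⟩ := Finite.exists_ne_map_eq_of_infinite fun n : ℕ => (1 + a) ^ n
    rcases lt_or_gt_of_ne hne with h | h
    · exact ⟨i, j, h, he⟩
    · exact ⟨j, i, h, he.symm⟩
  have hstep : a * (1 + a) ^ i ≤ (1 + a) ^ i :=
    calc a * (1 + a) ^ i ≤ (1 + a) * (1 + a) ^ i := mul_le_mul_left le_add_self _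
      _ = (1 + a) ^ (i + 1) := (pow_succ' _ _).symm
      _ ≤ (1 + a) ^ j := hmono hij
      _ = (1 + a) ^ i := he.symm
  have hle : a∗ ≤ (1 + a) ^ i :=
    kstar_le_of_mul_le_right (by simpa using hmono (Nat.zero_le i)) hstep
  calc φ (a∗) ≤ φ ((1 + a) ^ i) := map_mono φ hle
    _ = (1 + φ a) ^ i := by rw [map_pow, map_add, map_one]
    _ ≤ ((φ a)∗) ^ i := pow_le_pow_left' (add_le one_le_kstar le_kstar) i
    _ ≤ (φ a)∗ := by
      simpa using (pow_le_kstar (a := (φ a)∗) (n := i))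

end KStar

/-! ### Relations on a set -/

/-- The Kleene algebra of binary relations on `X`. -/
def RelAlg (X : Type*) : Type _ := X → X → Prop

namespace RelAlg

variable {X : Type*}

instance : Zero (RelAlg X) := ⟨fun _ _ => False⟩

instance : One (RelAlg X) := ⟨fun x y => x = y⟩

instance : Add (RelAlg X) := ⟨fun R S x y => R x y ∨ S x y⟩

instance : Mul (RelAlg X) := ⟨fun R S x z => ∃ y, R x y ∧ S y z⟩

@[ext]
theorem ext {R S : RelAlg X} (h : ∀ x y, R x y ↔ S x y) : R = S :=
  funext fun x => funext fun y => propext (h x y)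

theorem zero_apply (x y : X) : (0 : RelAlg X) x y ↔ False := Iff.rfl

theorem one_apply (x y : X) : (1 : RelAlg X) x y ↔ x = y := Iff.rfl

theorem add_apply (R S : RelAlg X) (x y : X) : (R + S) x y ↔ R x y ∨ S x y := Iff.rfl

theorem mul_apply (R S : RelAlg X) (x z : X) : (R * S) x z ↔ ∃ y, R x y ∧ S y z := Iff.rfl

instance : Semiring (RelAlg X) where
  nsmul := nsmulRec
  add_assoc R S T := ext fun x y => or_assoc
  zero_add R := ext fun x y => iff_of_eq (false_or _)
  add_zero R := ext fun x y => iff_of_eq (or_false _)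
  add_comm R S := ext fun x y => or_comm
  left_distrib R S T := ext fun x y => by simp [mul_apply, add_apply, and_or_left, exists_or]
  right_distrib R S T := ext fun x y => by simp [mul_apply, add_apply, or_and_right, exists_or]
  zero_mul R := ext fun x y => by simp [mul_apply, zero_apply]
  mul_zero R := ext fun x y => by simp [mul_apply, zero_apply]
  mul_assoc R S T := ext fun x y => by
    simp only [mul_apply]
    exact ⟨fun ⟨z, ⟨w, h1, h2⟩, h3⟩ => ⟨w, h1, z, h2, h3⟩,
      fun ⟨w, h1, z, h2, h3⟩ => ⟨z, ⟨w, h1, h2⟩, h3⟩⟩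
  one_mul R := ext fun x y => by simp [mul_apply, one_apply]
  mul_one R := ext fun x y => by simp [mul_apply, one_apply]

instance : IdemSemiring (RelAlg X) := IdemSemiring.ofSemiring fun _ => ext fun _ _ => or_self_iff

instance : KStar (RelAlg X) := ⟨fun R x y => ∃ n : ℕ, (R ^ n) x y⟩

theorem kstar_apply (R : RelAlg X) (x y : X) : R∗ x y ↔ ∃ n : ℕ, (R ^ n) x y := Iff.rfl

theorem le_iff {R S : RelAlg X} : R ≤ S ↔ ∀ x y, R x y → S x y := by
  rw [← add_eq_right_iff_le, RelAlg.ext_iff]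
  simp only [add_apply, or_iff_right_iff_imp]

theorem isLUB_aux (R S T : RelAlg X) :
    IsLUB (Set.range fun n : ℕ => R * T ^ n * S) (R * T∗ * S) := by
  rw [isLUB_iff_le_iff]
  intro Z
  simp only [mem_upperBounds, Set.forall_mem_range, le_iff, mul_apply, kstar_apply]
  exact ⟨fun H n x y ⟨z, ⟨w, h1, h2⟩, h3⟩ => H x y ⟨z, ⟨w, h1, n, h2⟩, h3⟩,
    fun H x y ⟨z, ⟨w, h1, n, h2⟩, h3⟩ => H n x y ⟨z, ⟨w, h1, h2⟩, h3⟩⟩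

instance : KleeneAlgebra (RelAlg X) := kleeneOfIsLUB isLUB_aux

instance : StarContinuous (RelAlg X) := ⟨isLUB_aux⟩

theorem sum_apply {ι : Type*} (s : Finset ι) (R : ι → RelAlg X) (x y : X) :
    (∑ i ∈ s, R i) x y ↔ ∃ i ∈ s, R i x y := by
  classical
  induction s using Finset.induction_on with
  | empty => simp [zero_apply]
  | insert a s ha ih => rw [Finset.sum_insert ha, add_apply, ih]; simp

end RelAlg

/-! ### The bra-ket algebras -/

namespace BraKet

variable {m : ℕ}

theorem p_mul_q (i j : Fin m) : (p i * q j : BraKet m) = if i = j then 1 else 0 := by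
  have h := (RQuot.mk_eq_iff (BraKetRel m)).2 (rCongruenceGen_of (.matching i j))
  rw [map_mul, apply_ite (RQuot.mk (BraKetRel m)), map_one, map_zero] at h
  exact h

theorem sum_q_mul_p : ∑ i : Fin m, (q i * p i : BraKet m) = 1 := by
  have h := (RQuot.mk_eq_iff (BraKetRel m)).2 (rCongruenceGen_of .completeness)
  simp only [map_sum, map_mul, map_one] at h
  exact h

/-- The action of the brackets on infinite sequences: `p i` prefixes `i`, `q i` removes it. -/
def streamRel : Bracket m → RelAlg (Stream' (Fin m))
  | .p i => fun x y => y = Stream'.cons i x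
  | .q i => fun x y => x = Stream'.cons i y

/-- The representation of the bra-ket algebra by relations on infinite sequences. -/
noncomputable def streamHom (m : ℕ) : BraKet m →+* RelAlg (Stream' (Fin m)) :=
  RQuot.lift (BraKetRel m) (evalHom (FreeMonoid.lift streamRel)) (evalHom_kstar _) (by
    rintro _ _ (⟨i, j⟩ | _)
    · rw [map_mul, apply_ite (evalHom _), map_one, map_zero]
      simp only [letter, evalHom_single, FreeMonoid.lift_eval_of]
      ext x y
      have h : (streamRel (.p i) * streamRel (.q j) : RelAlg (Stream' (Fin m))) x y ↔
          i = j ∧ x = y := by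
        rw [RelAlg.mul_apply]
        -- Composition reads from left to right: `p i` sends `x` to `cons i x`, and `q j` requires
        -- this to be `cons j y`.
        constructor
        · rintro ⟨_, rfl, h⟩
          exact Stream'.cons_injective2 h
        · rintro ⟨rfl, rfl⟩
          exact ⟨_, rfl, rfl⟩
      rw [h]
      split_ifs with hij
      · simp [hij, RelAlg.one_apply]
      · simp [hij, RelAlg.zero_apply]
    · simp only [map_sum, map_mul, map_one, letter, evalHom_single, FreeMonoid.lift_eval_of]
      ext x y
      rw [RelAlg.sum_apply, RelAlg.one_apply]
      constructor
      · rintro ⟨i, -, z, hx, hy⟩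
        exact hx.trans hy.symm
      · rintro rfl
        -- Completeness holds because every sequence has a first entry: remove it and put it back.
        exact ⟨x.head, Finset.mem_univ _, x.tail, (Stream'.eta x).symm, (Stream'.eta x).symm⟩)

/-- For `m > 0` a sequence exists, so the identity relation is not empty. -/
theorem zero_ne_one (h : 0 < m) : (0 : BraKet m) ≠ 1 := fun e => by
  have h1 := congrArg (streamHom m) e
  rw [map_zero, map_one] at h1
  have x : Stream' (Fin m) := fun _ => ⟨0, h⟩
  exact ((RelAlg.ext_iff.1 h1) x x).2 rfl

instance : Finite BoolKA := Finite.of_surjective (fun b : Bool => if b then (1 : BoolKA) else 0)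
  fun a => by
    rcases BoolKA.eq_zero_or_one a with rfl | rfl
    · exact ⟨false, rfl⟩
    · exact ⟨true, rfl⟩

instance (n : ℕ) : Finite (BoolMat n) :=
  inferInstanceAs (Finite (Matrix (Fin n) (Fin n) BoolKA))

/-- The bra-ket algebra has no interpretation by boolean matrices. -/
theorem isEmpty_hom_boolMat (hm : 2 ≤ m) {n : ℕ} (hn : 1 ≤ n) :
    IsEmpty (BraKet m →+* BoolMat n) := by
  refine ⟨fun φ => ?_⟩
  let i : Fin m := ⟨0, by omega⟩
  let j : Fin m := ⟨1, by omega⟩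
  have hij : j ≠ i := by simp [i, j]
  have h1 : φ (p i) * φ (q i) = 1 := by rw [← map_mul, p_mul_q, if_pos rfl, map_one]
  have h2 : φ (p j) * φ (q i) = 0 := by rw [← map_mul, p_mul_q, if_neg hij, map_zero]
  have h3 : φ (p j) * φ (q j) = 1 := by rw [← map_mul, p_mul_q, if_pos rfl, map_one]
  -- One-sided inverses in the finite monoid `BoolMat n` are two-sided.
  have h4 : φ (q i) * φ (p i) = 1 := mul_eq_one_symm h1
  have h5 : φ (p j) = 0 := by rw [← mul_one (φ (p j)), ← h4, ← mul_assoc, h2, zero_mul]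
  rw [h5, zero_mul] at h3
  have h6 := congrFun (congrFun h3 ⟨0, hn⟩) ⟨0, hn⟩
  rw [Matrix.zero_apply, Matrix.one_apply_eq] at h6
  exact BoolKA.zero_ne_one' h6

end BraKet

/-! ### The boolean semiring in an idempotent semiring -/

/-- The unique semiring homomorphism from the booleans. -/
def boolHom (K : Type*) [IdemSemiring K] : BoolKA →+* K where
  toFun
    | .zero => 0
    | .one => 1
  map_zero' := rfl
  map_one' := rfl
  map_add' a b := by
    cases a <;> cases b
    · exact (add_zero 0).symm
    · exact (zero_add 1).symm
    · exact (add_zero 1).symm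
    · exact (add_idem 1).symm
  map_mul' a b := by
    cases a
    · exact (zero_mul _).symm
    · exact (one_mul _).symm

/-- Boolean matrices as matrices over an idempotent semiring. -/
def boolMatHom (m : ℕ) (K : Type*) [IdemSemiring K] : BoolMat m →+* Matrix (Fin m) (Fin m) K :=
  (boolHom K).mapMatrix

theorem boolMatHom_apply {m : ℕ} {K : Type*} [IdemSemiring K] (B : BoolMat m) (i j : Fin m) :
    boolMatHom m K B i j = boolHom K (B i j) := rfl

theorem commute_boolHom {K : Type*} [IdemSemiring K] (a : K) (b : BoolKA) :
    Commute a (boolHom K b) := by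
  rcases BoolKA.eq_zero_or_one b with rfl | rfl
  · rw [map_zero]; exact Commute.zero_right a
  · rw [map_one]; exact Commute.one_right a

/-- The entries `0` and `1` are central. This supplies the commutation needed to define `ofTensor`
by `RTensor.lift`. -/
theorem commute_scalar_boolMatHom {m : ℕ} {K : Type*} [IdemSemiring K] (a : K) (B : BoolMat m) :
    Commute (Matrix.scalar (Fin m) a) (boolMatHom m K B) := by
  ext i j
  simp [boolMatHom_apply, (commute_boolHom a (B i j)).eq]

/-! ### Matrices over the bra-ket algebra -/

namespace BraKet

variable {m : ℕ}

theorem q_mul_p_mul_q_mul_p (x y : BraKet m) (i j k l : Fin m) :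
    q i * x * p j * (q k * y * p l) = if j = k then q i * (x * y) * p l else 0 := by
  have : q i * x * p j * (q k * y * p l) = q i * x * (p j * q k) * y * p l := by
    simp only [mul_assoc]
  rw [this, p_mul_q]
  split_ifs
  · simp only [mul_one, mul_assoc]
  · simp

/-- `Mat_m(C_m) ≅ C_m`, mapping `A` to `∑ q_i A_{ij} p_j`. -/
def matrixEquiv (m : ℕ) : Matrix (Fin m) (Fin m) (BraKet m) ≃+* BraKet m where
  toFun A := ∑ i, ∑ j, q i * A i j * p j
  invFun a := Matrix.of fun i j => p i * a * q j
  left_inv A := by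
    ext k l
    have h : ∀ i j : Fin m, p k * (q i * A i j * p j) * q l =
        if k = i then if j = l then A i j else 0 else 0 := fun i j => by
      have : p k * (q i * A i j * p j) * q l = (p k * q i) * A i j * (p j * q l) := by
        simp only [mul_assoc]
      rw [this, p_mul_q, p_mul_q]
      split_ifs <;> simp
    simp only [Matrix.of_apply, Finset.mul_sum, Finset.sum_mul, h]
    simp
  right_inv a := by
    have h : ∀ i j : Fin m, q i * (p i * a * q j) * p j = (q i * p i) * a * (q j * p j) :=
      fun i j => by simp only [mul_assoc]
    simp only [Matrix.of_apply, h, ← Finset.mul_sum, ← Finset.sum_mul, sum_q_mul_p]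
    simp
  map_add' A B := by
    simp only [Matrix.add_apply, mul_add, add_mul, Finset.sum_add_distrib]
  map_mul' A B := by
    simp only [Matrix.mul_apply, Finset.sum_mul]
    simp only [Finset.mul_sum]
    simp only [Finset.sum_mul, q_mul_p_mul_q_mul_p]
    refine Finset.sum_congr rfl fun i _ => ?_
    rw [Finset.sum_comm]
    refine Finset.sum_congr rfl fun j _ => ?_
    symm
    rw [Finset.sum_eq_single j (fun k _ hk => by simp [hk.symm]) (by simp)]
    simp

theorem matrixEquiv_apply (A : Matrix (Fin m) (Fin m) (BraKet m)) :
    matrixEquiv m A = ∑ i, ∑ j, q i * A i j * p j := rfl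

/-- The embedding of boolean matrices, `B ↦ ∑ B_{ij} q_i p_j`. -/
def ofBoolMat (m : ℕ) : BoolMat m →+* BraKet m :=
  (matrixEquiv m : _ →+* BraKet m).comp (boolMatHom m (BraKet m))

theorem ofBoolMat_apply (B : BoolMat m) :
    ofBoolMat m B = ∑ i, ∑ j, q i * boolHom (BraKet m) (B i j) * p j := rfl

theorem ofBoolMat_injective : Function.Injective (ofBoolMat m) := by
  intro A B h
  have h' := (matrixEquiv m).injective h
  ext i j
  -- The index itself excludes `m = 0`, the case in which `0 ≠ 1` is not available.
  have hm : 0 < m := i.pos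
  have hij := congrFun (congrFun h' i) j
  rw [boolMatHom_apply, boolMatHom_apply] at hij
  rcases BoolKA.eq_zero_or_one (A i j) with ha | ha <;>
    rcases BoolKA.eq_zero_or_one (B i j) with hb | hb <;> rw [ha, hb] at hij ⊢
  · rw [map_zero, map_one] at hij
    exact absurd hij (zero_ne_one hm)
  · rw [map_zero, map_one] at hij
    exact absurd hij.symm (zero_ne_one hm)

theorem ofBoolMat_kstar (B : BoolMat m) : ofBoolMat m (B∗) = (ofBoolMat m B)∗ :=
  map_kstar_of_finite _ B

/-- The range of `ofBoolMat` is closed under stars and contains each generator as the image of a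
matrix unit; conversely every image is a finite sum of generators. -/
theorem mem_closure_iff (x : BraKet m) :
    x ∈ (KleeneSubalgebra.closure
        {x : BraKet m | ∃ i j : Fin m, x = q i * p j}).toSubsemiring ↔
      ∃ B, ofBoolMat m B = x := by
  constructor
  · intro hx
    refine hx { (ofBoolMat m).rangeS with kstar_mem' := ?_ } ?_
    · rintro _ ⟨B, rfl⟩
      exact ⟨B∗, ofBoolMat_kstar B⟩
    · rintro _ ⟨i, j, rfl⟩
      refine ⟨Matrix.single i j 1, ?_⟩
      rw [ofBoolMat_apply, Finset.sum_eq_single i _ (by simp),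
        Finset.sum_eq_single j _ (by simp)]
      · simp
      · intro k _ hk
        simp [hk.symm]
      · intro k _ hk
        simp [hk.symm]
  · rintro ⟨B, rfl⟩
    rw [ofBoolMat_apply]
    refine Subsemiring.sum_mem _ fun i _ => Subsemiring.sum_mem _ fun j _ => ?_
    rcases BoolKA.eq_zero_or_one (B i j) with h | h
    · rw [h, map_zero, mul_zero, zero_mul]
      exact Subsemiring.zero_mem _
    · rw [h, map_one, mul_one]
      exact fun S hS => hS ⟨i, j, rfl⟩

end BraKet

/-- The inverse of an isomorphism of Kleene algebras. -/
def KleeneEquiv.symm {K L : Type*} [KleeneAlgebra K] [KleeneAlgebra L] (e : KleeneEquiv K L) :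
    KleeneEquiv L K where
  toRingEquiv := e.toRingEquiv.symm
  map_kstar' b := by
    obtain ⟨a, rfl⟩ := e.toRingEquiv.surjective b
    refine (congrArg e.toRingEquiv.symm (e.map_kstar' a).symm).trans ?_
    refine (e.toRingEquiv.symm_apply_apply _).trans ?_
    exact congrArg (fun x : K => x∗) (e.toRingEquiv.symm_apply_apply a).symm

namespace BraKet

variable {m : ℕ}

/-- Boolean matrices are isomorphic to the Kleene subalgebra generated by the `q_i p_j`. -/
noncomputable def boolMatEquiv (m : ℕ) : KleeneEquiv (BoolMat m)
    (KleeneSubalgebra.closure {x : BraKet m | ∃ i j : Fin m, x = q i * p j}).Elem where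
  toRingEquiv := RingEquiv.ofBijective
    ((ofBoolMat m).codRestrict
      (KleeneSubalgebra.closure {x : BraKet m | ∃ i j : Fin m, x = q i * p j}).toSubsemiring
      fun B => (mem_closure_iff _).2 ⟨B, rfl⟩)
    ⟨fun _ _ h => ofBoolMat_injective (congrArg Subtype.val h), fun ⟨x, hx⟩ => by
      obtain ⟨B, rfl⟩ := (mem_closure_iff x).1 hx
      exact ⟨B, rfl⟩⟩
  map_kstar' B := Subtype.ext (ofBoolMat_kstar B)

end BraKet

/-! ### Tensor products -/

namespace RTensor

/-- The multiplicative homomorphism `(x, y) ↦ s x * t y`. -/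
def pairHom {K L N : Type*} [Semiring K] [Semiring L] [Semiring N]
    (s : K →+* N) (t : L →+* N) (comm : ∀ x y, Commute (s x) (t y)) : K × L →* N where
  toFun z := s z.1 * t z.2
  map_one' := by simp
  map_mul' z w := by
    rw [Prod.fst_mul, Prod.snd_mul, map_mul, map_mul]
    exact (comm w.1 z.2).mul_mul_mul_comm _ _

theorem pairHom_apply {K L N : Type*} [Semiring K] [Semiring L] [Semiring N]
    (s : K →+* N) (t : L →+* N) (comm : ∀ x y, Commute (s x) (t y))
    (x : K) (y : L) : pairHom s t comm (x, y) = s x * t y := rfl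

section

variable {K L : Type*} [KleeneAlgebra K] [StarContinuous K] [KleeneAlgebra L] [StarContinuous L]

/-- The pure tensor `x ⊗ y`. -/
def tmul (x : K) (y : L) : RTensor K L := RQuot.mk (TensorRel K L) (RegSet.single (x, y))

theorem mk_prod {A : Set K} {B : Set L} (hA : IsRegular A) (hB : IsRegular B) {a : K} {b : L}
    (ha : IsLUB A a) (hb : IsLUB B b) (R : RegSet (K × L)) (hR : R.1 = A ×ˢ B) :
    RQuot.mk (TensorRel K L) R = tmul a b :=
  (RQuot.mk_eq_iff _).2 (rCongruenceGen_of (.intro hA hB ha hb R hR))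

theorem tmul_mul (x x' : K) (y y' : L) : tmul x y * tmul x' y' = tmul (x * x') (y * y') := by
  rw [tmul, tmul, ← map_mul]
  exact congrArg (RQuot.mk (TensorRel K L)) (Subtype.ext Set.singleton_mul_singleton)

theorem tmul_one_one : tmul (1 : K) (1 : L) = 1 := map_one (RQuot.mk (TensorRel K L))

/-- Biadditivity of pure tensors is the tensor equation for finite sets: `∅` has supremum `0`, and
`{x} ∪ {x'}` has supremum `x + x'`. -/
theorem zero_tmul (y : L) : tmul (0 : K) y = 0 := by
  rw [← map_zero (RQuot.mk (TensorRel K L))]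
  refine (mk_prod .empty (.singleton y) ?_ isLUB_singleton 0 Set.empty_prod.symm).symm
  simp [IsLUB, IsLeast, lowerBounds, upperBounds]

theorem tmul_zero (x : K) : tmul x (0 : L) = 0 := by
  rw [← map_zero (RQuot.mk (TensorRel K L))]
  refine (mk_prod (.singleton x) .empty isLUB_singleton ?_ 0 Set.prod_empty.symm).symm
  simp [IsLUB, IsLeast, lowerBounds, upperBounds]

theorem isLUB_insert_pair {R : Type*} [IdemSemiring R] (x y : R) : IsLUB ({x} ∪ {y}) (x + y) := by
  rw [add_eq_sup]
  exact isLUB_singleton.union isLUB_singleton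

theorem add_tmul (x x' : K) (y : L) : tmul (x + x') y = tmul x y + tmul x' y := by
  rw [tmul, tmul, tmul, ← map_add]
  refine (mk_prod ((IsRegular.singleton x).union (.singleton x')) (.singleton y)
    (isLUB_insert_pair x x') isLUB_singleton _ ?_).symm
  rw [Set.union_prod, Set.singleton_prod_singleton, Set.singleton_prod_singleton]
  rfl

theorem tmul_add (x : K) (y y' : L) : tmul x (y + y') = tmul x y + tmul x y' := by
  rw [tmul, tmul, tmul, ← map_add]
  refine (mk_prod (.singleton x) ((IsRegular.singleton y).union (.singleton y'))
    isLUB_singleton (isLUB_insert_pair y y') _ ?_).symm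
  rw [Set.prod_union, Set.singleton_prod_singleton, Set.singleton_prod_singleton]
  rfl

theorem sum_tmul {ι : Type*} (s : Finset ι) (f : ι → K) (y : L) :
    tmul (∑ i ∈ s, f i) y = ∑ i ∈ s, tmul (f i) y :=
  map_sum (⟨⟨fun x => tmul x y, zero_tmul y⟩, fun x x' => add_tmul x x' y⟩ : K →+ RTensor K L) f s

theorem tmul_sum {ι : Type*} (s : Finset ι) (x : K) (f : ι → L) :
    tmul x (∑ i ∈ s, f i) = ∑ i ∈ s, tmul x (f i) :=
  map_sum (⟨⟨fun y => tmul x y, tmul_zero x⟩, tmul_add x⟩ : L →+ RTensor K L) f s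

/-- Tensor equation for `A = {c ^ n}` and `B = {1}`, since `A × B` is the iteration of `{(c, 1)}`.
-/
theorem kstar_tmul_one (c : K) : tmul (c∗) (1 : L) = (tmul c (1 : L))∗ := by
  have hA : IsRegular (Set.range fun n : ℕ => c ^ n) := by simpa using isRegular_range 1 1 c
  have hl : IsLUB (Set.range fun n : ℕ => c ^ n) (c∗) := by
    simpa using StarContinuous.isLUB_mul_kstar_mul 1 1 c
  refine (mk_prod hA (.singleton 1) hl isLUB_singleton ((RegSet.single (c, 1))∗) ?_).symm
  have h (n : ℕ) : ({(c, 1)} : Set (K × L)) ^ n = {(c ^ n, 1)} := by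
    rw [Set.singleton_pow, Prod.pow_mk, one_pow]
  change (⋃ n : ℕ, ({(c, 1)} : Set (K × L)) ^ n) = _
  ext ⟨u, v⟩
  simp [h, eq_comm]

/-- Star-preserving homomorphisms that agree on pure tensors are equal. -/
theorem hom_ext {N : Type*} [KleeneAlgebra N] {φ ψ : RTensor K L →+* N}
    (hφ : ∀ x, φ (x∗) = (φ x)∗) (hψ : ∀ x, ψ (x∗) = (ψ x)∗)
    (h : ∀ x y, φ (tmul x y) = ψ (tmul x y)) (t : RTensor K L) : φ t = ψ t := by
  obtain ⟨⟨U, hU⟩, rfl⟩ := RQuot.mk_surjective _ t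
  induction hU with
  | empty => exact (map_zero (φ.comp (RQuot.mk _))).trans (map_zero (ψ.comp (RQuot.mk _))).symm
  | singleton a => exact h a.1 a.2
  | @union A B hA hB ihA ihB =>
    exact (map_add (φ.comp (RQuot.mk _)) ⟨A, hA⟩ ⟨B, hB⟩).trans
      ((congrArg₂ (· + ·) ihA ihB).trans
        (map_add (ψ.comp (RQuot.mk _)) ⟨A, hA⟩ ⟨B, hB⟩).symm)
  | @mul A B hA hB ihA ihB =>
    exact (map_mul (φ.comp (RQuot.mk _)) ⟨A, hA⟩ ⟨B, hB⟩).trans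
      ((congrArg₂ (· * ·) ihA ihB).trans
        (map_mul (ψ.comp (RQuot.mk _)) ⟨A, hA⟩ ⟨B, hB⟩).symm)
  | @star A hA ih =>
    exact (hφ (RQuot.mk _ ⟨A, hA⟩)).trans ((congrArg KStar.kstar ih).trans
      (hψ (RQuot.mk _ ⟨A, hA⟩)).symm)

variable {N : Type*} [KleeneAlgebra N] [StarContinuous N]

/-- The homomorphism on the tensor product induced by two commuting star-preserving
homomorphisms. -/
noncomputable def lift (s : K →+* N) (t : L →+* N) (hs : ∀ x, s (x∗) = (s x)∗)
    (ht : ∀ y, t (y∗) = (t y)∗) (comm : ∀ x y, Commute (s x) (t y)) : RTensor K L →+* N :=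
  RQuot.lift (TensorRel K L)
    (evalHom (pairHom s t comm)) (evalHom_kstar _) (by
      intro R _ hR
      obtain ⟨hA, hB, ha, hb, _, hR⟩ := hR
      refine (isMulLUB_evalHom _ R).unique ?_
      rw [evalHom_single, hR]
      intro c d X
      simp only [Set.mem_prod, Prod.forall, pairHom_apply, and_imp, ← mul_assoc]
      -- The supremum over `B` is taken first; the one over `A` then has `t y * d` as its right
      -- factor.
      rw [isMulLUB_map ht hB hb]
      have h (y : L) := isMulLUB_map hs hA ha c (t y * d) X
      simp only [← mul_assoc] at h
      simp only [h]
      exact ⟨fun H x y hx hy => H y hy x hx, fun H y hy x hx => H x y hx hy⟩)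

theorem lift_tmul (s : K →+* N) (t : L →+* N) (hs : ∀ x, s (x∗) = (s x)∗)
    (ht : ∀ y, t (y∗) = (t y)∗) (comm : ∀ x y, Commute (s x) (t y)) (x : K) (y : L) :
    lift s t hs ht comm (tmul x y) = s x * t y :=
  evalHom_single _ (x, y)

theorem lift_kstar (s : K →+* N) (t : L →+* N) (hs : ∀ x, s (x∗) = (s x)∗)
    (ht : ∀ y, t (y∗) = (t y)∗) (comm : ∀ x y, Commute (s x) (t y)) (x : RTensor K L) :
    lift s t hs ht comm (x∗) = (lift s t hs ht comm x)∗ :=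
  RQuot.lift_kstar _ _ _ _ x

end

/-! ### Matrices over `K` and the tensor product with boolean matrices -/

section Matrix

variable {K : Type*} [KleeneAlgebra K] [StarContinuous K] {m : ℕ}

/-- The homomorphism `Mat_m(K) → K ⊗ Mat_m(𝔹)`, `A ↦ ∑ A_{ij} ⊗ E_{ij}`. -/
noncomputable def ofMatrix (K : Type*) [KleeneAlgebra K] [StarContinuous K] (m : ℕ) :
    Matrix (Fin m) (Fin m) K →+* RTensor K (BoolMat m) where
  toFun A := ∑ i, ∑ j, tmul (A i j) (Matrix.single i j 1)
  map_zero' := by simp [zero_tmul]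
  map_one' := by
    have h (i j : Fin m) : tmul ((1 : Matrix (Fin m) (Fin m) K) i j)
        (Matrix.single i j 1 : BoolMat m) =
          if i = j then tmul 1 (Matrix.single i j 1) else 0 := by
      rw [Matrix.one_apply]
      split_ifs
      · rfl
      · exact zero_tmul _
    simp only [h, Finset.sum_ite_eq, Finset.mem_univ, if_true]
    rw [← tmul_sum, ← tmul_one_one]
    congr 1
    ext i j
    simp [Matrix.sum_apply, Matrix.single_apply, Matrix.one_apply, ite_and]
  map_add' A B := by simp only [Matrix.add_apply, add_tmul, Finset.sum_add_distrib]
  map_mul' A B := by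
    have h (i j k l : Fin m) : tmul (A i j) (Matrix.single i j 1 : BoolMat m) *
        tmul (B k l) (Matrix.single k l 1) =
          if j = k then tmul (A i j * B k l) (Matrix.single i l 1) else 0 := by
      rw [tmul_mul]
      split_ifs with hjk
      · rw [hjk, Matrix.single_mul_single_same, mul_one]
      · rw [Matrix.single_mul_single_of_ne _ _ _ _ hjk, tmul_zero]
    simp only [Matrix.mul_apply, Finset.sum_mul]
    simp only [Finset.mul_sum, sum_tmul, h]
    refine Finset.sum_congr rfl fun i _ => ?_
    rw [Finset.sum_comm]
    refine Finset.sum_congr rfl fun j _ => ?_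
    symm
    rw [Finset.sum_eq_single j (fun k _ hk => by simp [hk.symm]) (by simp)]
    simp

theorem ofMatrix_apply (A : Matrix (Fin m) (Fin m) K) :
    ofMatrix K m A = ∑ i, ∑ j, tmul (A i j) (Matrix.single i j 1) := rfl

theorem ofMatrix_scalar_mul (a : K) (B : BoolMat m) :
    ofMatrix K m (Matrix.scalar (Fin m) a * boolMatHom m K B) = tmul a B := by
  have h (i j : Fin m) :
      tmul ((Matrix.scalar (Fin m) a * boolMatHom m K B) i j) (Matrix.single i j 1 : BoolMat m) =
        tmul a (Matrix.single i j (B i j)) := by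
    rw [Matrix.scalar_apply, Matrix.diagonal_mul, boolMatHom_apply]
    -- A boolean entry can be moved across the tensor sign.
    rcases BoolKA.eq_zero_or_one (B i j) with hb | hb
    · rw [hb, map_zero, mul_zero, zero_tmul, Matrix.single_zero, tmul_zero]
    · rw [hb, map_one, mul_one]
  simp only [ofMatrix_apply, h, ← tmul_sum]
  rw [← Matrix.matrix_eq_sum_single]

end Matrix

end RTensor

/-! ### The isomorphism of `C_m` with its tensor product by boolean matrices -/

namespace BraKet

variable {m : ℕ}

/-- The endomorphism `a ↦ ∑ q_i a p_i`. -/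
def diagHom (m : ℕ) : BraKet m →+* BraKet m :=
  (matrixEquiv m : _ →+* BraKet m).comp (Matrix.scalar (Fin m))

theorem diagHom_apply (a : BraKet m) : diagHom m a = ∑ i, q i * a * p i := by
  change matrixEquiv m (Matrix.scalar (Fin m) a) = _
  rw [matrixEquiv_apply]
  refine Finset.sum_congr rfl fun i _ => ?_
  rw [Finset.sum_eq_single i (fun j _ hj => by simp [hj.symm]) (by simp)]
  simp

/-- By star-continuity each `q_i a∗ p_i` is the supremum of the `q_i a ^ n p_i`, which are summands
of `(diagHom m a) ^ n`. -/
theorem diagHom_kstar (a : BraKet m) : diagHom m (a∗) = (diagHom m a)∗ := by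
  refine le_antisymm ?_ (kstar_map_le _ a)
  rw [diagHom_apply]
  refine Finset.sum_induction _ (· ≤ (diagHom m a)∗) (fun _ _ => add_le) bot_le fun i hi => ?_
  rw [isLUB_le_iff (StarContinuous.isLUB_mul_kstar_mul _ _ _)]
  rintro _ ⟨n, rfl⟩
  refine le_trans ?_ (pow_le_kstar (n := n))
  rw [← map_pow, diagHom_apply]
  exact Finset.single_le_sum_of_canonicallyOrdered (f := fun i => q i * a ^ n * p i) hi

/-- The homomorphism `C_m → C_m ⊗ Mat_m(𝔹)`, `a ↦ ∑ p_i a q_j ⊗ E_{ij}`. -/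
noncomputable def toTensor (m : ℕ) : BraKet m →+* RTensor (BraKet m) (BoolMat m) :=
  (RTensor.ofMatrix (BraKet m) m).comp ((matrixEquiv m).symm : BraKet m →+* _)

theorem toTensor_apply (a : BraKet m) :
    toTensor m a = ∑ i, ∑ j, RTensor.tmul (p i * a * q j) (Matrix.single i j 1) := rfl

theorem toTensor_kstar (a : BraKet m) : toTensor m (a∗) = (toTensor m a)∗ := by
  refine le_antisymm ?_ (kstar_map_le _ a)
  -- Isolating `b ⊗ 1` as a middle factor turns `a∗ ⊗ 1` into `(a ⊗ 1)∗`, to which star-continuity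
  -- applies.
  have hsplit (b : BraKet m) (i j : Fin m) :
      RTensor.tmul (p i * b * q j) (Matrix.single i j 1 : BoolMat m) =
        RTensor.tmul (p i) (Matrix.single i j 1) * RTensor.tmul b 1 * RTensor.tmul (q j) 1 := by
    rw [RTensor.tmul_mul, RTensor.tmul_mul, mul_one, mul_one]
  have hpow (n : ℕ) : RTensor.tmul (a ^ n) (1 : BoolMat m) = RTensor.tmul a 1 ^ n := by
    induction n with
    | zero => rw [pow_zero, pow_zero, RTensor.tmul_one_one]
    | succ n ih => rw [pow_succ, pow_succ, ← ih, RTensor.tmul_mul, mul_one]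
  rw [toTensor_apply]
  refine Finset.sum_induction _ (· ≤ (toTensor m a)∗) (fun _ _ => add_le) bot_le fun i hi => ?_
  refine Finset.sum_induction _ (· ≤ (toTensor m a)∗) (fun _ _ => add_le) bot_le fun j hj => ?_
  rw [hsplit, RTensor.kstar_tmul_one,
    isLUB_le_iff (StarContinuous.isLUB_mul_kstar_mul _ _ _)]
  rintro _ ⟨n, rfl⟩
  refine le_trans ?_ (pow_le_kstar (n := n))
  beta_reduce
  rw [← hpow, ← hsplit, ← map_pow, toTensor_apply]
  refine le_trans ?_ (Finset.single_le_sum_of_canonicallyOrdered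
    (f := fun i => ∑ j, RTensor.tmul (p i * a ^ n * q j) (Matrix.single i j 1 : BoolMat m)) hi)
  exact Finset.single_le_sum_of_canonicallyOrdered
    (f := fun j => RTensor.tmul (p i * a ^ n * q j) (Matrix.single i j 1 : BoolMat m)) hj

/-- The homomorphism `C_m ⊗ Mat_m(𝔹) → C_m`, `a ⊗ B ↦ ∑ q_i (a B_{ij}) p_j`. -/
noncomputable def ofTensor (m : ℕ) : RTensor (BraKet m) (BoolMat m) →+* BraKet m :=
  RTensor.lift (diagHom m) (ofBoolMat m) diagHom_kstar ofBoolMat_kstar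
    fun a B => (commute_scalar_boolMatHom a B).map (matrixEquiv m)

theorem ofTensor_tmul (a : BraKet m) (B : BoolMat m) :
    ofTensor m (RTensor.tmul a B) =
      matrixEquiv m (Matrix.scalar (Fin m) a * boolMatHom m (BraKet m) B) := by
  rw [map_mul]
  exact RTensor.lift_tmul _ _ _ _ _ a B

theorem ofTensor_kstar (x : RTensor (BraKet m) (BoolMat m)) :
    ofTensor m (x∗) = (ofTensor m x)∗ :=
  RTensor.lift_kstar _ _ _ _ _ x

/-- Both maps preserve stars, so only pure tensors need checking; there `matrixEquiv` cancels and
`ofMatrix_scalar_mul` remains. -/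
theorem toTensor_ofTensor (x : RTensor (BraKet m) (BoolMat m)) :
    toTensor m (ofTensor m x) = x := by
  refine RTensor.hom_ext (φ := (toTensor m).comp (ofTensor m)) (ψ := RingHom.id _)
    (fun x => ?_) (fun x => rfl) (fun a B => ?_) x
  · rw [RingHom.comp_apply, RingHom.comp_apply, ofTensor_kstar, toTensor_kstar]
  · rw [RingHom.comp_apply, ofTensor_tmul]
    change RTensor.ofMatrix (BraKet m) m ((matrixEquiv m).symm (matrixEquiv m _)) = _
    rw [RingEquiv.symm_apply_apply, RTensor.ofMatrix_scalar_mul, RingHom.id_apply]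

theorem matrixEquiv_scalar_mul_single (a : BraKet m) (i j : Fin m) :
    matrixEquiv m (Matrix.scalar (Fin m) a * boolMatHom m (BraKet m) (Matrix.single i j 1)) =
      q i * a * p j := by
  have h (k l : Fin m) :
      (Matrix.scalar (Fin m) a * boolMatHom m (BraKet m) (Matrix.single i j 1)) k l =
        if i = k ∧ j = l then a else 0 := by
    rw [Matrix.scalar_apply, Matrix.diagonal_mul, boolMatHom_apply, Matrix.single_apply,
      apply_ite (boolHom _), map_one, map_zero, mul_ite, mul_one, mul_zero]
  rw [matrixEquiv_apply]
  simp only [h]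
  rw [Finset.sum_eq_single i (fun k _ hk => by simp [hk.symm]) (by simp),
    Finset.sum_eq_single j (fun k _ hk => by simp [hk.symm]) (by simp)]
  simp

theorem ofTensor_toTensor (a : BraKet m) : ofTensor m (toTensor m a) = a := by
  rw [toTensor_apply]
  simp only [map_sum, ofTensor_tmul, matrixEquiv_scalar_mul_single]
  -- The sum is now `∑ q_i (p_i a q_j) p_j`.
  exact (matrixEquiv m).apply_symm_apply a

/-- The isomorphism `C_m ≅ C_m ⊗ Mat_m(𝔹)`. -/
noncomputable def tensorEquiv (m : ℕ) :
    KleeneEquiv (BraKet m) (RTensor (BraKet m) (BoolMat m)) where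
  toFun := toTensor m
  invFun := ofTensor m
  left_inv := ofTensor_toTensor
  right_inv := toTensor_ofTensor
  map_mul' := map_mul (toTensor m)
  map_add' := map_add (toTensor m)
  map_kstar' := toTensor_kstar

end BraKet
end StarKA

theorem mainTheorem12 (m : ℕ) :
    Nonempty (StarKA.KleeneEquiv
      (StarKA.KleeneSubalgebra.closure
        {x : StarKA.BraKet m | ∃ i j : Fin m, x = StarKA.BraKet.q i * StarKA.BraKet.p j}).Elem
      (StarKA.BoolMat m)) ∧
    Nonempty (StarKA.KleeneEquiv
      (StarKA.BraKet m) (StarKA.RTensor (StarKA.BraKet m) (StarKA.BoolMat m))) ∧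
    (2 ≤ m → ∀ n : ℕ, 1 ≤ n → IsEmpty (StarKA.BraKet m →+* StarKA.BoolMat n)) :=
  ⟨⟨(StarKA.BraKet.boolMatEquiv m).symm⟩, ⟨StarKA.BraKet.tensorEquiv m⟩,
    fun hm _ hn => StarKA.BraKet.isEmpty_hom_boolMat hm hn⟩
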